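/- **Theorem (Finite-Blocklength List-Version).** Throughout, $\log$ is the base-2 and $\ln$ the natural logarithm, $a\wedge b=\min\{a,b\}$ and $a\vee b=\max\{a,b\}$. Let $\mathcal X,\mathcal Y,\mathcal M_1,\mathcal M_2$ be finite sets, $P_{X,Y}$ a PMF on $\mathcal X\times\mathcal Y$, and $\rho>0$; put $\tilde\rho=1/(1+\rho)$ and let $$H_{\alpha}(X|Y)=\frac{\alpha}{1-\alpha}\log\sum_{y\in\mathcal Y}\Bigl(\sum_{x\in\mathcal X}P_{X,Y}(x,y)^{\alpha}\Bigr)^{1/\alpha}$$ be the conditional Rényi entropy. The pair $(X,Y)$ is drawn according to $P_{X,Y}$, and upon observing $(X,Y)=(x,y)$ Alice draws the hints $(M_1,M_2)\in\mathcal M_1\times\mathcal M_2$ according to a conditional PMF $\Pr[M_1=m_1,M_2=m_2\mid X=x,Y=y]$. Bob observes $(Y,M_1,M_2)$; his ambiguity is $$\mathscr A_{\mathrm B}^{(\mathrm l)}=\mathbb E\bigl[|\mathcal L^Y_{M_1,M_2}|^\rho\bigr],\qquad \mathcal L^y_{m_1,m_2}=\{x:\Pr[X=x\mid Y=y,M_1=m_1,M_2=m_2]>0\}.$$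 Eve observes $Y$ and one of the hints. Her ambiguity is $$\mathscr A_{\mathrm E}=\min_{G_1,G_2}\mathbb E\bigl[G_1(X|Y,M_1)^\rho\wedge G_2(X|Y,M_2)^\rho\bigr],$$ and we also let $$\tilde{\mathscr A}_{\mathrm E}=\min_{k\in\{1,2\}}\min_{G_k}\mathbb E\bigl[G_k(X|Y,M_k)^\rho\bigr],$$ where $G_k$ ranges over the guessing functions for $X$ given $(Y,M_k)$, i.e. $G_k(\cdot|y,m_k)$ is a bijection $\mathcal X\to\{1,\dots,|\mathcal X|\}$ for every $(y,m_k)\in\mathcal Y\times\mathcal M_k$. *Achievability.* If $|\mathcal M_1|\,|\mathcal M_2|>\log|\mathcal X|+2$, then for all positive integers $c_{\mathrm s},c_1,c_2$ satisfying $$c_{\mathrm s}\le|\mathcal M_1|\wedge|\mathcal M_2|,\quad c_1\le\lfloor|\mathcal M_1|/c_{\mathrm s}\rfloor,\quad c_2\le\lfloor|\mathcal M_2|/c_{\mathrm s}\rfloor,\quad c_{\mathrm s}c_1c_2>\log|\mathcal X|+2,$$ there is a choice of Alice's conditional PMF for which both $$\mathscr A_{\mathrm B}^{(\mathrm l)}<1+2^{\rho(H_{\tilde\rho}(X|Y)-\log(c_{\mathrm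 s}c_1c_2-\log|\mathcal X|-2)+2)}$$ and $$\mathscr A_{\mathrm E}\ge(1+\ln|\mathcal X|)^{-\rho}\,2^{\rho(H_{\tilde\rho}(X|Y)-\log(c_1+c_2))}.$$ *Converse.* For every choice of Alice's conditional PMF, $$\mathscr A_{\mathrm B}^{(\mathrm l)}\ge 2^{\rho(H_{\tilde\rho}(X|Y)-\log(|\mathcal M_1|\,|\mathcal M_2|))}\vee 1,$$ $$\mathscr A_{\mathrm E}\le\Bigl[\bigl(|\mathcal M_1|\wedge|\mathcal M_2|\bigr)^\rho\,\mathscr A_{\mathrm B}^{(\mathrm l)}\Bigr]\wedge 2^{\rho H_{\tilde\rho}(X|Y)},$$ and the last inequality also holds with $\tilde{\mathscr A}_{\mathrm E}$ in place of $\mathscr A_{\mathrm E}$. -/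

import Mathlib

namespace DistStor

noncomputable section

/-- Conditional Rényi entropy (Arimoto), in bits, of order `α ∈ (0,1) ∪ (1,∞)`:
`H_α(X|Y) = α/(1-α) · log₂ ∑_y (∑_x P(x,y)^α)^{1/α}`. -/
def condRenyiEntropy {X Y : Type*} [Fintype X] [Fintype Y] (α : ℝ) (P : PMF (X × Y)) : ℝ :=
  α / (1 - α) * Real.logb 2 (∑ y, (∑ x, (P (x, y)).toReal ^ α) ^ (1 / α))

/-- A guessing function for `X` given an observation in `S`: for each observation a bijection from
`X` onto the `|X|` positions of the guessing order (position `i : Fin |X|` is guess number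
`i + 1`, see `guessNo`). -/
abbrev GuessFun (X S : Type*) [Fintype X] : Type _ := S → X ≃ Fin (Fintype.card X)

/-- `G(x|s) ∈ {1, …, |X|}`, the number of guesses needed when the observation is `s` and the
realization is `x`. -/
def guessNo {X S : Type*} [Fintype X] (G : GuessFun X S) (x : X) (s : S) : ℕ :=
  (G s x : ℕ) + 1

/-- Alice's encoder: a conditional PMF of the hint pair `(M₁, M₂)` given `(X, Y)`. -/
abbrev Encoder (X Y M₁ M₂ : Type*) : Type _ := X × Y → PMF (M₁ × M₂)

section

variable {X Y M₁ M₂ : Type*} [Fintype X] [Fintype Y] [Fintype M₁] [Fintype M₂]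

/-- Joint probability of `X = x, Y = y, M₁ = m₁, M₂ = m₂`. -/
def jointProb (P : PMF (X × Y)) (W : Encoder X Y M₁ M₂) (x : X) (y : Y) (m₁ : M₁) (m₂ : M₂) : ℝ :=
  (P (x, y)).toReal * (W (x, y) (m₁, m₂)).toReal

/-- Expectation of `f(X, Y, M₁, M₂)` under the joint law. -/
def expect (P : PMF (X × Y)) (W : Encoder X Y M₁ M₂) (f : X → Y → M₁ → M₂ → ℝ) : ℝ :=
  ∑ x, ∑ y, ∑ m₁, ∑ m₂, jointProb P W x y m₁ m₂ * f x y m₁ m₂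

/-- Posterior probability of `X = x` given `Y = y, M₁ = m₁, M₂ = m₂`
(zero if the conditioning event has probability zero). -/
def posterior (P : PMF (X × Y)) (W : Encoder X Y M₁ M₂) (x : X) (y : Y) (m₁ : M₁) (m₂ : M₂) : ℝ :=
  jointProb P W x y m₁ m₂ / ∑ x', jointProb P W x' y m₁ m₂

/-- Bob's list: all realizations of `X` of positive posterior probability. -/
def bobList (P : PMF (X × Y)) (W : Encoder X Y M₁ M₂) (y : Y) (m₁ : M₁) (m₂ : M₂) : Set X :=
  {x | 0 < posterior P W x y m₁ m₂}

/-- Bob's ambiguity in the list version: the `ρ`-th moment of the size of his list. -/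
def bobListAmbiguity (ρ : ℝ) (P : PMF (X × Y)) (W : Encoder X Y M₁ M₂) : ℝ :=
  expect P W fun _ y m₁ m₂ => ((bobList P W y m₁ m₂).ncard : ℝ) ^ ρ

/-- Eve's ambiguity: the accomplice sees `(X, Y)` and reveals the better hint. There are only
finitely many guessing functions and at least one, so the infimum is a minimum. -/
def eveAmbiguity (ρ : ℝ) (P : PMF (X × Y)) (W : Encoder X Y M₁ M₂) : ℝ :=
  ⨅ G : GuessFun X (Y × M₁) × GuessFun X (Y × M₂),
    expect P W fun x y m₁ m₂ =>
      min ((guessNo G.1 x (y, m₁) : ℝ) ^ ρ) ((guessNo G.2 x (y, m₂) : ℝ) ^ ρ)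

/-- Eve's alternative ambiguity: the revealed hint does not depend on the realization of `(X, Y)`.
The infima are minima. -/
def eveAltAmbiguity (ρ : ℝ) (P : PMF (X × Y)) (W : Encoder X Y M₁ M₂) : ℝ :=
  min
    (⨅ G : GuessFun X (Y × M₁), expect P W fun x y m₁ _ => (guessNo G x (y, m₁) : ℝ) ^ ρ)
    (⨅ G : GuessFun X (Y × M₂), expect P W fun x y _ m₂ => (guessNo G x (y, m₂) : ℝ) ^ ρ)

end

end

end DistStor

namespace DistStor

open Finset

/-! Write q = P(x,y)^{1/(1+ρ)}. Every 2^{ρ(H - log c)} in the statement equals c^{-ρ} ∑_y (∑_x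
q)^{1+ρ} (`two_rpow_entropy_sub`), so entropies disappear from the argument.

Both lower bounds rest on `sum_rpow_le_moment_mul`: the ρ-th moment of a positive quantity a is
large when ∑ 1/a is small. For Bob, a is the list size; each nonempty list contributes 1 to ∑ 1/a,
so |M₁||M₂| bounds the sum. For Eve, a is the smaller of her two guess numbers; for each hint value
the reciprocal guess numbers have sum at most 1 + ln|X|.

Eve's upper bounds come from two strategies: ignore the hints and guess by decreasing probability,
or take the hint with the larger alphabet and run through the lists Bob might hold, smallest first
(`exists_equiv_fin_succ_le_card_mul_ncard`).

For achievability, X is split, for each y, into at most c_s c₁ c₂ blocks, the block of x having size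
at most about const/q (`exists_partition`, `exists_description`). The block label is (vₛ, v₁, v₂),
with vₛ masked by a one-time pad. Both hints together undo the pad, so Bob's list lies within one
block; a single hint tells only v₁ or only v₂ about x, whence the factor c₁ + c₂ for Eve. -/

/-- Reverse Hölder inequality behind all lower bounds on guessing moments. -/
theorem sum_rpow_le_moment_mul {ι : Type*} (s : Finset ι) {ρ : ℝ} (hρ : 0 < ρ) (w a : ι → ℝ)
    (hw : ∀ i ∈ s, 0 ≤ w i) (ha : ∀ i ∈ s, 0 < a i) :
    (∑ i ∈ s, w i ^ (1 / (1 + ρ))) ^ (1 + ρ) ≤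
      (∑ i ∈ s, w i * a i ^ ρ) * (∑ i ∈ s, (a i)⁻¹) ^ ρ := by
  have h1 : (0 : ℝ) < 1 + ρ := by linarith
  have hpq : (1 + ρ).HolderConjugate ((1 + ρ) / ρ) := by
    rw [Real.holderConjugate_iff]
    refine ⟨by linarith, ?_⟩
    field_simp
  have hf : ∀ i ∈ s, 0 ≤ w i * a i ^ ρ := fun i hi =>
    mul_nonneg (hw i hi) (Real.rpow_nonneg (ha i hi).le _)
  have hg : ∀ i ∈ s, 0 ≤ (a i)⁻¹ := fun i hi => inv_nonneg.2 (ha i hi).le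
  have key := Real.inner_le_Lp_mul_Lq_of_nonneg s hpq
    (f := fun i => (w i * a i ^ ρ) ^ (1 / (1 + ρ)))
    (g := fun i => ((a i)⁻¹) ^ (ρ / (1 + ρ)))
    (fun i hi => Real.rpow_nonneg (hf i hi) _) (fun i hi => Real.rpow_nonneg (hg i hi) _)
  have e1 : ∑ i ∈ s, (w i * a i ^ ρ) ^ (1 / (1 + ρ)) * ((a i)⁻¹) ^ (ρ / (1 + ρ)) =
      ∑ i ∈ s, w i ^ (1 / (1 + ρ)) := by
    refine sum_congr rfl fun i hi => ?_
    have hai := ha i hi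
    rw [Real.mul_rpow (hw i hi) (Real.rpow_nonneg hai.le _), ← Real.rpow_mul hai.le,
      Real.inv_rpow hai.le, mul_one_div, mul_assoc,
      mul_inv_cancel₀ (Real.rpow_pos_of_pos hai _).ne', mul_one]
  have e2 : ∑ i ∈ s, ((w i * a i ^ ρ) ^ (1 / (1 + ρ))) ^ (1 + ρ) = ∑ i ∈ s, w i * a i ^ ρ := by
    refine sum_congr rfl fun i hi => ?_
    rw [← Real.rpow_mul (hf i hi), one_div_mul_cancel h1.ne', Real.rpow_one]
  have e3 : ∑ i ∈ s, (((a i)⁻¹) ^ (ρ / (1 + ρ))) ^ ((1 + ρ) / ρ) = ∑ i ∈ s, (a i)⁻¹ := by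
    refine sum_congr rfl fun i hi => ?_
    rw [← Real.rpow_mul (hg i hi), div_mul_div_cancel₀ h1.ne', div_self hρ.ne', Real.rpow_one]
  rw [e1, e2, e3] at key
  have hA : 0 ≤ ∑ i ∈ s, w i * a i ^ ρ := sum_nonneg hf
  have hB : 0 ≤ ∑ i ∈ s, (a i)⁻¹ := sum_nonneg hg
  have := Real.rpow_le_rpow
    (sum_nonneg fun i hi => Real.rpow_nonneg (hw i hi) _) key h1.le
  rwa [Real.mul_rpow (Real.rpow_nonneg hA _) (Real.rpow_nonneg hB _), ← Real.rpow_mul hA,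
    ← Real.rpow_mul hB, one_div_mul_cancel h1.ne', Real.rpow_one, one_div_div,
    div_mul_cancel₀ _ h1.ne'] at this

/-! ### Guessing orders and partitions into small blocks -/

/-- The elements of a finite type can be listed in increasing order of a real key. -/
theorem exists_equiv_fin_succ_le_card {X : Type*} [Fintype X] (h : X → ℝ) :
    ∃ e : X ≃ Fin (Fintype.card X),
      ∀ x, (e x : ℕ) + 1 ≤ #{x' | h x' ≤ h x} := by
  classical
  let e₀ := Fintype.equivFin X
  let σ := Tuple.sort (h ∘ e₀.symm)
  have hmono : Monotone ((h ∘ e₀.symm) ∘ σ) := Tuple.monotone_sort _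
  refine ⟨e₀.trans σ.symm, fun x => ?_⟩
  set e : X ≃ Fin (Fintype.card X) := e₀.trans σ.symm with he
  have hsub : (Finset.Iic (e x)).map e.symm.toEmbedding ⊆ ({x' | h x' ≤ h x} : Finset X) := by
    intro x' hx'
    simp only [Finset.mem_map, Finset.mem_Iic, Equiv.coe_toEmbedding] at hx'
    obtain ⟨i, hi, rfl⟩ := hx'
    have := hmono hi
    simpa [he] using this
  calc (e x : ℕ) + 1 = #((Finset.Iic (e x)).map e.symm.toEmbedding) := by simp
    _ ≤ _ := card_le_card hsub

/-- A family of sets can be guessed so that every member of a set of the family is found after at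
most as many guesses as the size of that set times the number of sets. -/
theorem exists_equiv_fin_succ_le_card_mul_ncard {X B : Type*} [Fintype X] [Fintype B]
    (L : B → Set X) :
    ∃ e : X ≃ Fin (Fintype.card X),
      ∀ b, ∀ x ∈ L b, (e x : ℕ) + 1 ≤ Fintype.card B * (L b).ncard := by
  classical
  let S : X → Finset ℕ := fun x => ({b | x ∈ L b} : Finset B).image fun b => (L b).ncard
  -- The key is the size of the smallest set containing `x`. Elements in no set get a value above
  -- every set size, so they are guessed last.
  let h : X → ℕ := fun x => if hx : (S x).Nonempty then (S x).min' hx else Fintype.card X + 1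
  have hle : ∀ b, ∀ x ∈ L b, h x ≤ (L b).ncard := by
    intro b x hx
    have hmem : (L b).ncard ∈ S x := by
      simp only [S, mem_image, mem_filter, mem_univ, true_and]
      exact ⟨b, hx, rfl⟩
    have hne : (S x).Nonempty := ⟨_, hmem⟩
    simp only [h, dif_pos hne]
    exact min'_le _ _ hmem
  have hex : ∀ x, h x ≤ Fintype.card X → ∃ b, x ∈ L b ∧ (L b).ncard = h x := by
    intro x hx
    by_cases hS : (S x).Nonempty
    · have := min'_mem _ hS
      simp only [S, mem_image, mem_filter, mem_univ, true_and] at this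
      obtain ⟨b, hb, hb'⟩ := this
      exact ⟨b, hb, by simp only [h, dif_pos hS]; exact hb'⟩
    · simp only [h, dif_neg hS] at hx
      omega
  obtain ⟨e, he⟩ := exists_equiv_fin_succ_le_card fun x => (h x : ℝ)
  refine ⟨e, fun b x hx => (he x).trans ?_⟩
  have hbX : (L b).ncard ≤ Fintype.card X := by
    rw [← Nat.card_eq_fintype_card]; exact Set.ncard_le_card _
  -- Whatever is guessed no later than `x` lies in a set no larger than `L b`, and there are at most
  -- |B| such sets.
  have hsub : ({x' | (h x' : ℝ) ≤ h x} : Finset X) ⊆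
      ({b' | (L b').ncard ≤ (L b).ncard} : Finset B).biUnion fun b' => (L b').toFinset := by
    intro x' hx'
    simp only [mem_filter, mem_univ, true_and, Nat.cast_le] at hx'
    obtain ⟨b', hb', hcard⟩ := hex x' (hx'.trans ((hle b x hx).trans hbX))
    simp only [mem_biUnion, mem_filter, mem_univ, true_and, Set.mem_toFinset]
    exact ⟨b', by rw [hcard]; exact hx'.trans (hle b x hx), hb'⟩
  refine (card_le_card hsub).trans ((card_biUnion_le_card_mul _ _ (L b).ncard ?_).trans ?_)
  · intro b' hb'
    rw [← Set.ncard_eq_toFinset_card']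
    simpa using hb'
  · exact Nat.mul_le_mul_right _ (card_le_univ _)

/-- A finite set can be cut into blocks of size at most `s`, using `⌈|C| / s⌉` blocks. -/
theorem exists_blocks {X : Type*} (C : Finset X) {s : ℕ} (hs : 0 < s) :
    ∃ g : C → Fin ((#C + s - 1) / s), ∀ j, #{x | g x = j} ≤ s := by
  classical
  have hlt : ∀ x : C, (C.equivFin x : ℕ) / s < (#C + s - 1) / s := by
    intro x
    have := (C.equivFin x).2
    rw [Nat.lt_iff_add_one_le, Nat.le_div_iff_mul_le hs, Nat.add_mul, one_mul]
    have := Nat.div_mul_le_self (C.equivFin x : ℕ) s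
    omega
  refine ⟨fun x => ⟨_, hlt x⟩, fun j => ?_⟩
  calc #{x : C | (⟨(C.equivFin x : ℕ) / s, hlt x⟩ : Fin _) = j}
      ≤ #(Finset.Ico (j * s : ℕ) (j * s + s)) := by
        refine card_le_card_of_injOn (fun x => (C.equivFin x : ℕ)) ?_ ?_
        · intro x hx
          have hx' : (C.equivFin x : ℕ) / s = j := by simpa [Fin.ext_iff] using hx
          have h1 := Nat.div_add_mod (C.equivFin x : ℕ) s
          have h2 := Nat.mod_lt (C.equivFin x : ℕ) hs
          rw [hx', mul_comm] at h1
          simp only [coe_Ico, Set.mem_Ico]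
          omega
        · intro x _ x' _ hxx
          exact C.equivFin.injective (Fin.ext hxx)
    _ = s := by simp

/-- If the prescribed block sizes `lam` satisfy `∑ 1 / lam ≤ T / 2`, then `T + log₂ n + 2` blocks
suffice for every element to lie in a block not larger than prescribed. -/
theorem exists_partition {X Z : Type*} [Fintype X] [Nonempty X] [Fintype Z] (A : Finset X)
    (lam : X → ℕ) (hlam : ∀ x ∈ A, 0 < lam x) {T : ℝ}
    (hT : 2 * ∑ x ∈ A, (lam x : ℝ)⁻¹ ≤ T)
    (hZ : T + Real.logb 2 (Fintype.card X) + 2 ≤ Fintype.card Z) :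
    ∃ f : X → Z, ∀ x ∈ A, Set.ncard {x' | x' ∈ A ∧ f x' = f x} ≤ lam x := by
  classical
  set n := Fintype.card X with hn
  have hn0 : 0 < n := Fintype.card_pos
  set K := Nat.clog 2 n with hK
  -- Dyadic classes 2^k ≤ lam < 2^{k+1}, each cut into blocks of size 2^k. The `none` label of `Q`
  -- serves all of `A` with lam ≥ n, where the size constraint is vacuous.
  let C : Fin K → Finset X := fun k => {x ∈ A | lam x < n ∧ Nat.log 2 (lam x) = k}
  choose g hg using fun k => exists_blocks (C k) (s := 2 ^ (k : ℕ)) (by positivity)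
  let Q := Option (Σ k : Fin K, Fin ((#(C k) + 2 ^ (k : ℕ) - 1) / 2 ^ (k : ℕ)))
  have hdisj : ∑ k : Fin K, ∑ x ∈ C k, (lam x : ℝ)⁻¹ ≤ ∑ x ∈ A, (lam x : ℝ)⁻¹ := by
    rw [← sum_biUnion]
    · refine sum_le_sum_of_subset_of_nonneg ?_ fun _ _ _ => by positivity
      intro x hx
      simp only [mem_biUnion, C, mem_filter] at hx
      obtain ⟨_, _, h, _⟩ := hx
      exact h
    · intro k _ k' _ hkk
      refine Finset.disjoint_left.2 fun x hx hx' => hkk ?_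
      simp only [C, mem_filter] at hx hx'
      exact Fin.ext (hx.2.2.symm.trans hx'.2.2)
  -- The factor 2 is the dyadic loss lam < 2^{k+1}; the 1 is the incomplete last block. Over all
  -- classes this costs T + K, plus 1 for `none`, and K ≤ log₂ n + 1.
  have hclass : ∀ k : Fin K, (((#(C k) + 2 ^ (k : ℕ) - 1) / 2 ^ (k : ℕ) : ℕ) : ℝ) ≤
      2 * ∑ x ∈ C k, (lam x : ℝ)⁻¹ + 1 := by
    intro k
    have h2 : (0 : ℝ) < 2 ^ (k : ℕ) := by positivity
    have h3 : (#(C k) : ℝ) / 2 ^ (k : ℕ) ≤ 2 * ∑ x ∈ C k, (lam x : ℝ)⁻¹ := by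
      rw [mul_sum, div_eq_mul_inv, ← nsmul_eq_mul]
      refine card_nsmul_le_sum _ _ _ fun x hx => ?_
      simp only [C, mem_filter] at hx
      have hpos := hlam x hx.1
      have hlt : lam x < 2 ^ ((k : ℕ) + 1) := by
        rw [← hx.2.2]; exact Nat.lt_pow_succ_log_self (by norm_num) _
      have hlt' : (lam x : ℝ) ≤ 2 ^ (k : ℕ) * 2 := by
        rw [← pow_succ]; exact_mod_cast hlt.le
      have hp : (0 : ℝ) < lam x := by exact_mod_cast hpos
      rw [← div_eq_mul_inv, inv_eq_one_div, div_le_div_iff₀ h2 hp]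
      linarith
    have h4 : ((#(C k) + 2 ^ (k : ℕ) - 1 : ℕ) : ℝ) ≤ #(C k) + 2 ^ (k : ℕ) := by
      exact_mod_cast Nat.sub_le _ _
    calc (((#(C k) + 2 ^ (k : ℕ) - 1) / 2 ^ (k : ℕ) : ℕ) : ℝ)
        ≤ ((#(C k) + 2 ^ (k : ℕ) - 1 : ℕ) : ℝ) / ((2 ^ (k : ℕ) : ℕ) : ℝ) := Nat.cast_div_le
      _ ≤ (#(C k) + 2 ^ (k : ℕ)) / 2 ^ (k : ℕ) := by push_cast; gcongr
      _ = (#(C k) : ℝ) / 2 ^ (k : ℕ) + 1 := by rw [add_div, div_self h2.ne']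
      _ ≤ _ := by linarith
  have hKlog : (K : ℝ) ≤ Real.logb 2 n + 1 := by
    rcases Nat.eq_zero_or_pos K with h0 | h0
    · rw [h0]
      have := Real.logb_nonneg (b := 2) (x := n) (by norm_num) (by exact_mod_cast hn0)
      push_cast; linarith
    · have h1 : 2 ^ (K - 1) < n := by
        rw [← Nat.lt_clog_iff_pow_lt (by norm_num)]; omega
      have h2 : ((K - 1 : ℕ) : ℝ) ≤ Real.logb 2 n := by
        rw [Real.le_logb_iff_rpow_le (by norm_num) (by exact_mod_cast hn0), Real.rpow_natCast]
        exact_mod_cast h1.le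
      rw [Nat.cast_sub h0] at h2
      push_cast at h2; linarith
  have hcard : Fintype.card Q ≤ Fintype.card Z := by
    have h1 : (Fintype.card Q : ℝ) ≤ 2 * ∑ x ∈ A, (lam x : ℝ)⁻¹ + K + 1 := by
      simp only [Q, Fintype.card_option, Fintype.card_sigma, Fintype.card_fin]
      push_cast
      have := sum_le_sum fun k (_ : k ∈ univ) => hclass k
      rw [sum_add_distrib, ← mul_sum] at this
      simp only [sum_const, card_univ, Fintype.card_fin, nsmul_eq_mul, mul_one] at this
      linarith
    have : (Fintype.card Q : ℝ) ≤ Fintype.card Z := by linarith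
    exact_mod_cast this
  obtain ⟨ι⟩ := Function.Embedding.nonempty_of_card_le hcard
  have hmemC : ∀ x, x ∈ A → lam x < n → ∃ k, x ∈ C k := by
    intro x hx hlt
    refine ⟨⟨Nat.log 2 (lam x), ?_⟩, ?_⟩
    · rw [hK, Nat.lt_clog_iff_pow_lt (by norm_num)]
      exact (Nat.pow_log_le_self 2 (hlam x hx).ne').trans_lt hlt
    · simp [C, hx, hlt]
  let F : X → Q := fun x =>
    if hx : ∃ k, x ∈ C k then some ⟨hx.choose, g _ ⟨x, hx.choose_spec⟩⟩ else none
  have hF : ∀ k x (hx : x ∈ C k), F x = some ⟨k, g k ⟨x, hx⟩⟩ := by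
    intro k x hx
    have hex : ∃ k, x ∈ C k := ⟨k, hx⟩
    have hk : hex.choose = k := by
      exact Fin.ext ((mem_filter.1 hex.choose_spec).2.2.symm.trans (mem_filter.1 hx).2.2)
    simp only [F, dif_pos hex]
    have : ∀ k' (h' : x ∈ C k'), k' = k →
        (some ⟨k', g k' ⟨x, h'⟩⟩ : Q) = some ⟨k, g k ⟨x, hx⟩⟩ := by
      rintro k' h' rfl; rfl
    exact this _ _ hk
  refine ⟨fun x => ι (F x), fun x hx => ?_⟩
  by_cases hlt : lam x < n
  · obtain ⟨k, hk⟩ := hmemC x hx hlt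
    have hsub : {x' | x' ∈ A ∧ ι (F x') = ι (F x)} ⊆
        (((({y | g k y = g k ⟨x, hk⟩} : Finset (C k)).map (Function.Embedding.subtype _)) :
          Finset X) : Set X) := by
      rintro x' ⟨hx', hxx⟩
      have hxx := ι.injective hxx
      rw [hF k x hk] at hxx
      by_cases hex : ∃ k, x' ∈ C k
      · obtain ⟨k', hk'⟩ := hex
        rw [hF k' x' hk'] at hxx
        have h1 := Option.some.inj hxx
        obtain rfl : k' = k := congrArg Sigma.fst h1
        have h2 := eq_of_heq (Sigma.mk.inj h1).2
        simp only [coe_map, Set.mem_image, mem_coe, mem_filter, mem_univ, true_and]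
        exact ⟨⟨x', hk'⟩, h2, rfl⟩
      · simp [F, hex] at hxx
    refine (Set.ncard_le_ncard hsub (Finset.finite_toSet _)).trans ?_
    rw [Set.ncard_coe_finset, card_map]
    refine (hg k _).trans ?_
    simp only [C, mem_filter] at hk
    rw [← hk.2.2]
    exact Nat.pow_log_le_self 2 (hlam x hx).ne'
  · refine le_trans ?_ (not_lt.1 hlt)
    rw [hn, ← Nat.card_eq_fintype_card]
    exact Set.ncard_le_card _

/-- The guess numbers of a guessing order have harmonic reciprocal sum. -/
theorem sum_inv_guess_le {X : Type*} [Fintype X] (e : X ≃ Fin (Fintype.card X)) :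
    ∑ x, (((e x : ℕ) + 1 : ℕ) : ℝ)⁻¹ ≤ 1 + Real.log (Fintype.card X) := by
  rw [Equiv.sum_comp e fun i => (((i : ℕ) + 1 : ℕ) : ℝ)⁻¹,
    Fin.sum_univ_eq_sum_range fun i => ((i + 1 : ℕ) : ℝ)⁻¹]
  have := harmonic_le_one_add_log (Fintype.card X)
  rw [harmonic] at this
  push_cast at this ⊢
  exact this

/-! ### Posterior lists and the one-time-pad encoder -/

/-- `2 ^ (ρ H)` for the conditional Rényi entropy `H` of order `1 / (1 + ρ)`. -/
noncomputable def renyiSum {X Y : Type*} [Fintype X] [Fintype Y] (ρ : ℝ) (P : PMF (X × Y)) : ℝ :=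
  ∑ y, (∑ x, (P (x, y)).toReal ^ (1 / (1 + ρ))) ^ (1 + ρ)

theorem jointProb_nonneg {X Y M₁ M₂ : Type*} (P : PMF (X × Y)) (W : Encoder X Y M₁ M₂)
    (x : X) (y : Y) (m₁ : M₁) (m₂ : M₂) : 0 ≤ jointProb P W x y m₁ m₂ :=
  mul_nonneg ENNReal.toReal_nonneg ENNReal.toReal_nonneg

theorem mem_bobList_iff {X Y M₁ M₂ : Type*} [Fintype X] (P : PMF (X × Y))
    (W : Encoder X Y M₁ M₂) (x : X) (y : Y) (m₁ : M₁) (m₂ : M₂) :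
    x ∈ bobList P W y m₁ m₂ ↔ 0 < jointProb P W x y m₁ m₂ := by
  have h0 := jointProb_nonneg P W x y m₁ m₂
  rw [bobList, Set.mem_ofPred_eq, posterior]
  refine ⟨fun h => h0.lt_of_ne fun h1 => ?_, fun h => div_pos h ?_⟩
  · rw [← h1, zero_div] at h
    exact h.false
  · exact sum_pos' (fun x' _ => jointProb_nonneg P W x' y m₁ m₂) ⟨x, mem_univ _, h⟩

theorem one_le_ncard_bobList {X Y M₁ M₂ : Type*} [Fintype X] {P : PMF (X × Y)}
    {W : Encoder X Y M₁ M₂} {x : X} {y : Y} {m₁ : M₁} {m₂ : M₂}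
    (h : 0 < jointProb P W x y m₁ m₂) : 1 ≤ (bobList P W y m₁ m₂).ncard :=
  (Set.ncard_pos (Set.toFinite _)).2 ⟨x, (mem_bobList_iff P W x y m₁ m₂).2 h⟩

/-- Alice describes `x` by `f x y = (vₛ, v₁, v₂)`, draws a uniform one-time pad `u`, and stores
`(vₛ + u, v₁)` in the first hint and `(u, v₂)` in the second. -/
noncomputable def padEncoder {X Y M₁ M₂ : Type*} {cs c₁ c₂ : ℕ} [NeZero cs] (i₁ : Fin cs × Fin c₁ → M₁)
    (i₂ : Fin cs × Fin c₂ → M₂) (f : X → Y → Fin cs × Fin c₁ × Fin c₂) : Encoder X Y M₁ M₂ :=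
  fun p => (PMF.uniformOfFintype (Fin cs)).map fun u =>
    (i₁ ((f p.1 p.2).1 + u, (f p.1 p.2).2.1), i₂ (u, (f p.1 p.2).2.2))

/-- The second hint reveals the pad `u`, so the first reveals vₛ; any `x'` compatible with both
hints shares the full description of `x`. -/
theorem bobList_padEncoder_subset {X Y M₁ M₂ : Type*} [Fintype X] {cs c₁ c₂ : ℕ} [NeZero cs]
    (P : PMF (X × Y)) {i₁ : Fin cs × Fin c₁ → M₁} {i₂ : Fin cs × Fin c₂ → M₂} (hi₁ : Function.Injective i₁) (hi₂ : Function.Injective i₂)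
    (f : X → Y → Fin cs × Fin c₁ × Fin c₂) {x : X} {y : Y} {m₁ : M₁} {m₂ : M₂}
    (hx : 0 < jointProb P (padEncoder i₁ i₂ f) x y m₁ m₂) :
    bobList P (padEncoder i₁ i₂ f) y m₁ m₂ ⊆
      {x' | x' ∈ ({x | 0 < (P (x, y)).toReal} : Finset X) ∧ f x' y = f x y} := by
  have main : ∀ x, 0 < jointProb P (padEncoder i₁ i₂ f) x y m₁ m₂ → 0 < (P (x, y)).toReal ∧
      ∃ u, i₁ ((f x y).1 + u, (f x y).2.1) = m₁ ∧ i₂ (u, (f x y).2.2) = m₂ := by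
    intro x hx
    refine ⟨pos_of_mul_pos_left hx ENNReal.toReal_nonneg, ?_⟩
    have h2 : 0 < (padEncoder i₁ i₂ f (x, y) (m₁, m₂)).toReal :=
      pos_of_mul_pos_right hx ENNReal.toReal_nonneg
    have h3 : (m₁, m₂) ∈ (padEncoder i₁ i₂ f (x, y)).support := by
      rw [PMF.mem_support_iff]
      intro h0
      rw [h0] at h2
      simp at h2
    rw [padEncoder, PMF.mem_support_map_iff] at h3
    obtain ⟨u, _, hu⟩ := h3
    exact ⟨u, congrArg Prod.fst hu, congrArg Prod.snd hu⟩
  intro x' hx'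
  obtain ⟨-, u, h1, h2⟩ := main x hx
  obtain ⟨hp, u', h1', h2'⟩ := main x' ((mem_bobList_iff ..).1 hx')
  have e1 := Prod.ext_iff.1 (hi₁ (h1'.trans h1.symm))
  have e2 := Prod.ext_iff.1 (hi₂ (h2'.trans h2.symm))
  refine ⟨by simpa using hp, ?_⟩
  have hu : u' = u := e2.1
  have hs : (f x' y).1 + u' = (f x y).1 + u := e1.1
  rw [hu] at hs
  exact Prod.ext (add_right_cancel hs) (Prod.ext e1.2 e2.2)

/-! ### Entropy and expectation identities -/

section

variable {X Y M₁ M₂ : Type*} [Fintype X] [Fintype Y] [Fintype M₁] [Fintype M₂]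

theorem sum_toReal_pmf {α : Type*} [Fintype α] (p : PMF α) : ∑ a, (p a).toReal = 1 := by
  rw [← ENNReal.toReal_sum fun a _ => p.apply_ne_top a, ← tsum_fintype (L := .unconditional _),
    p.tsum_coe, ENNReal.toReal_one]

theorem renyiSum_pos {ρ : ℝ} (P : PMF (X × Y)) : 0 < renyiSum ρ P := by
  obtain ⟨⟨x, y⟩, hxy⟩ := P.support_nonempty
  have hp : 0 < (P (x, y)).toReal :=
    ENNReal.toReal_pos ((P.mem_support_iff _).1 hxy) (P.apply_ne_top _)
  have hn : ∀ y x, 0 ≤ (P (x, y)).toReal ^ (1 / (1 + ρ)) := fun y x => by positivity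
  refine sum_pos' (fun y _ => Real.rpow_nonneg (sum_nonneg fun x _ => hn y x) _)
    ⟨y, mem_univ _, Real.rpow_pos_of_pos ?_ _⟩
  exact sum_pos' (fun x _ => hn y x) ⟨x, mem_univ _, Real.rpow_pos_of_pos hp _⟩

/-- At α = 1/(1+ρ) the prefactor α/(1-α) is 1/ρ, which cancels the ρ in the exponent. -/
theorem two_rpow_entropy_sub {ρ : ℝ} (hρ : 0 < ρ) (P : PMF (X × Y)) {c : ℝ} (hc : 0 < c) :
    (2 : ℝ) ^ (ρ * (condRenyiEntropy (1 / (1 + ρ)) P - Real.logb 2 c)) =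
      renyiSum ρ P * c ^ (-ρ) := by
  have h1 : (1 / (1 + ρ)) / (1 - 1 / (1 + ρ)) = 1 / ρ := by
    have : 1 + ρ ≠ 0 := by positivity
    rw [one_sub_div this, add_sub_cancel_left, div_div_div_cancel_right₀ this]
  have hK : condRenyiEntropy (1 / (1 + ρ)) P = 1 / ρ * Real.logb 2 (renyiSum ρ P) := by
    rw [condRenyiEntropy, h1, one_div_one_div, renyiSum]
  have h2 : ρ * (condRenyiEntropy (1 / (1 + ρ)) P - Real.logb 2 c) =
      Real.logb 2 (renyiSum ρ P) + Real.logb 2 c * (-ρ) := by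
    rw [hK]; field_simp; ring
  rw [h2, Real.rpow_add two_pos, Real.rpow_mul two_pos.le,
    Real.rpow_logb two_pos (by norm_num) (renyiSum_pos P),
    Real.rpow_logb two_pos (by norm_num) hc]

theorem two_rpow_entropy {ρ : ℝ} (hρ : 0 < ρ) (P : PMF (X × Y)) :
    (2 : ℝ) ^ (ρ * condRenyiEntropy (1 / (1 + ρ)) P) = renyiSum ρ P := by
  have := two_rpow_entropy_sub hρ P one_pos
  rwa [Real.logb_one, sub_zero, Real.one_rpow, mul_one] at this

theorem expect_mono (P : PMF (X × Y)) (W : Encoder X Y M₁ M₂) {f g : X → Y → M₁ → M₂ → ℝ}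
    (h : ∀ x y m₁ m₂, 0 < jointProb P W x y m₁ m₂ → f x y m₁ m₂ ≤ g x y m₁ m₂) :
    expect P W f ≤ expect P W g := by
  refine sum_le_sum fun x _ => sum_le_sum fun y _ => sum_le_sum fun m₁ _ => sum_le_sum fun m₂ _ => ?_
  rcases (jointProb_nonneg P W x y m₁ m₂).eq_or_lt with h0 | h0
  · rw [← h0, zero_mul, zero_mul]
  · exact mul_le_mul_of_nonneg_left (h _ _ _ _ h0) h0.le

theorem expect_eq_sum (P : PMF (X × Y)) (W : Encoder X Y M₁ M₂) (f : X → Y → M₁ → M₂ → ℝ) :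
    expect P W f = ∑ y, ∑ x, (P (x, y)).toReal *
      ∑ m : M₁ × M₂, (W (x, y) m).toReal * f x y m.1 m.2 := by
  rw [expect, sum_comm]
  refine sum_congr rfl fun y _ => sum_congr rfl fun x _ => ?_
  rw [Fintype.sum_prod_type, mul_sum]
  refine sum_congr rfl fun m₁ _ => ?_
  rw [mul_sum]
  exact sum_congr rfl fun m₂ _ => by rw [jointProb, mul_assoc]

theorem expect_const_hint (P : PMF (X × Y)) (W : Encoder X Y M₁ M₂) (f : X → Y → ℝ) :
    expect P W (fun x y _ _ => f x y) = ∑ y, ∑ x, (P (x, y)).toReal * f x y := by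
  rw [expect_eq_sum]
  refine sum_congr rfl fun y _ => sum_congr rfl fun x _ => ?_
  rw [← sum_mul, sum_toReal_pmf, one_mul]

theorem sum_sum_toReal (P : PMF (X × Y)) : ∑ y, ∑ x, (P (x, y)).toReal = 1 := by
  rw [sum_comm, ← Fintype.sum_prod_type fun p => (P p).toReal, sum_toReal_pmf]

theorem expect_const_mul (P : PMF (X × Y)) (W : Encoder X Y M₁ M₂) (c : ℝ)
    (f : X → Y → M₁ → M₂ → ℝ) :
    expect P W (fun x y m₁ m₂ => c * f x y m₁ m₂) = c * expect P W f := by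
  simp only [expect, mul_sum, mul_left_comm]

/-! ### Converse bounds -/

theorem one_le_bobListAmbiguity {ρ : ℝ} (hρ : 0 < ρ) (P : PMF (X × Y)) (W : Encoder X Y M₁ M₂) :
    1 ≤ bobListAmbiguity ρ P W := by
  have h1 : expect P W (fun _ _ _ _ => (1 : ℝ)) = 1 := by
    rw [expect_const_hint P W fun _ _ => 1]
    simpa using sum_sum_toReal P
  rw [← h1]
  exact expect_mono P W fun x y m₁ m₂ h =>
    Real.one_le_rpow (by exact_mod_cast one_le_ncard_bobList h) hρ.le

/-- For each y, reverse Hölder is applied over the triples (x, m₁, m₂) of positive joint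
probability, with a the list size. -/
theorem renyiSum_le_bobListAmbiguity_mul {ρ : ℝ} (hρ : 0 < ρ) (P : PMF (X × Y))
    (W : Encoder X Y M₁ M₂) :
    renyiSum ρ P ≤ bobListAmbiguity ρ P W *
      ((Fintype.card M₁ : ℝ) * (Fintype.card M₂ : ℝ)) ^ ρ := by
  classical
  rw [bobListAmbiguity, expect_eq_sum, renyiSum, sum_mul]
  refine sum_le_sum fun y _ => ?_
  have hα : 0 < 1 / (1 + ρ) := by positivity
  set J : X × (M₁ × M₂) → ℝ := fun i => jointProb P W i.1 y i.2.1 i.2.2 with hJ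
  set L : X × (M₁ × M₂) → ℝ := fun i => ((bobList P W y i.2.1 i.2.2).ncard : ℝ) with hL
  set s : Finset (X × (M₁ × M₂)) := {i | 0 < J i} with hs
  have hJ0 : ∀ i, 0 ≤ J i := fun i => jointProb_nonneg ..
  have hJs : ∀ i, i ∉ s → J i = 0 := fun i hi =>
    le_antisymm (not_lt.1 fun h => hi (by simp [hs, h])) (hJ0 i)
  have key := sum_rpow_le_moment_mul s hρ J L (fun i _ => hJ0 i) fun i hi => by
    have : 0 < J i := by simpa [hs] using hi
    have := one_le_ncard_bobList this
    simp only [hL]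
    exact_mod_cast this
  have e1 : ∑ x, (P (x, y)).toReal ^ (1 / (1 + ρ)) ≤ ∑ i ∈ s, J i ^ (1 / (1 + ρ)) := by
    rw [sum_subset (subset_univ s) fun i _ hi => by rw [hJs i hi, Real.zero_rpow hα.ne'],
      Fintype.sum_prod_type]
    refine sum_le_sum fun x _ => ?_
    -- Splitting P(x,y) among hints only increases the sum of 1/(1+ρ)-th powers, since probabilities
    -- are at most 1.
    have hle : ∀ m : M₁ × M₂, (W (x, y) m).toReal ≤ (W (x, y) m).toReal ^ (1 / (1 + ρ)) := by
      intro m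
      have h1 : (W (x, y) m).toReal ≤ 1 := by
        have := ENNReal.toReal_mono ENNReal.one_ne_top ((W (x, y)).coe_le_one m)
        simpa using this
      refine Real.self_le_rpow_of_le_one ENNReal.toReal_nonneg h1 ?_
      rw [div_le_one (by positivity)]; linarith
    calc (P (x, y)).toReal ^ (1 / (1 + ρ))
        = (P (x, y)).toReal ^ (1 / (1 + ρ)) * ∑ m, (W (x, y) m).toReal := by
          rw [sum_toReal_pmf, mul_one]
      _ ≤ (P (x, y)).toReal ^ (1 / (1 + ρ)) * ∑ m, (W (x, y) m).toReal ^ (1 / (1 + ρ)) := by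
          gcongr with m _
          exact hle m
      _ = _ := by
          rw [mul_sum]
          refine sum_congr rfl fun m _ => ?_
          simp only [hJ, jointProb]
          rw [Real.mul_rpow ENNReal.toReal_nonneg ENNReal.toReal_nonneg]
  have e2 : ∑ i ∈ s, J i * L i ^ ρ = ∑ x, (P (x, y)).toReal * ∑ m : M₁ × M₂,
      (W (x, y) m).toReal * ((bobList P W y m.1 m.2).ncard : ℝ) ^ ρ := by
    rw [sum_subset (subset_univ s) fun i _ hi => by rw [hJs i hi, zero_mul],
      Fintype.sum_prod_type]
    refine sum_congr rfl fun x _ => ?_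
    rw [mul_sum]
    exact sum_congr rfl fun m _ => by simp only [hJ, hL, jointProb, mul_assoc]
  have e3 : ∑ i ∈ s, (L i)⁻¹ ≤ (Fintype.card M₁ : ℝ) * (Fintype.card M₂ : ℝ) := by
    rw [hs, sum_filter, Fintype.sum_prod_type, sum_comm]
    calc ∑ m : M₁ × M₂, ∑ x, (if 0 < J (x, m) then (L (x, m))⁻¹ else 0)
        ≤ ∑ _m : M₁ × M₂, (1 : ℝ) := by
          refine sum_le_sum fun m _ => ?_
          rw [← sum_filter]
          change ∑ x with 0 < J (x, m), ((bobList P W y m.1 m.2).ncard : ℝ)⁻¹ ≤ 1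
          rw [sum_const, nsmul_eq_mul]
          have : #{x | 0 < J (x, m)} = (bobList P W y m.1 m.2).ncard := by
            rw [← Set.ncard_coe_finset]
            congr 1
            ext x
            simp [mem_bobList_iff, hJ]
          rw [this]
          -- A nonempty list gives exactly 1; an empty one gives 0, because 0⁻¹ = 0.
          exact mul_inv_le_one
      _ = _ := by simp
  have hS : 0 ≤ ∑ x, (P (x, y)).toReal ^ (1 / (1 + ρ)) :=
    sum_nonneg fun x _ => by positivity
  have hL0 : ∀ i, 0 ≤ L i := fun i => Nat.cast_nonneg _
  rw [← e2]
  calc _ ≤ (∑ i ∈ s, J i ^ (1 / (1 + ρ))) ^ (1 + ρ) :=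
        Real.rpow_le_rpow hS e1 (by positivity)
    _ ≤ _ := key
    _ ≤ _ := by
        refine mul_le_mul_of_nonneg_left (Real.rpow_le_rpow ?_ e3 hρ.le) ?_
        · exact sum_nonneg fun i _ => inv_nonneg.2 (hL0 i)
        · exact sum_nonneg fun i _ => mul_nonneg (hJ0 i) (Real.rpow_nonneg (hL0 i) _)

instance (S : Type*) : Nonempty (GuessFun X S) := ⟨fun _ => Fintype.equivFin X⟩

theorem ciInf_guess_le {S : Type*} [Finite S] (F : GuessFun X S → ℝ) (G : GuessFun X S) :
    ⨅ G, F G ≤ F G :=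
  ciInf_le (Set.finite_range F).bddBelow G

theorem eveAmbiguity_le_expect {ρ : ℝ} (P : PMF (X × Y)) (W : Encoder X Y M₁ M₂)
    (G : GuessFun X (Y × M₁) × GuessFun X (Y × M₂)) :
    eveAmbiguity ρ P W ≤ expect P W fun x y m₁ m₂ =>
      min ((guessNo G.1 x (y, m₁) : ℝ) ^ ρ) ((guessNo G.2 x (y, m₂) : ℝ) ^ ρ) :=
  ciInf_le (f := fun G : GuessFun X (Y × M₁) × GuessFun X (Y × M₂) => expect P W fun x y m₁ m₂ =>
      min ((guessNo G.1 x (y, m₁) : ℝ) ^ ρ) ((guessNo G.2 x (y, m₂) : ℝ) ^ ρ))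
    (Set.finite_range _).bddBelow G

theorem eveAmbiguity_le_eveAltAmbiguity {ρ : ℝ} (P : PMF (X × Y)) (W : Encoder X Y M₁ M₂) :
    eveAmbiguity ρ P W ≤ eveAltAmbiguity ρ P W := by
  refine le_min (le_ciInf fun G => ?_) (le_ciInf fun G => ?_)
  · exact (eveAmbiguity_le_expect P W (G, Classical.arbitrary _)).trans
      (expect_mono P W fun x y m₁ m₂ _ => min_le_left _ _)
  · exact (eveAmbiguity_le_expect P W (Classical.arbitrary _, G)).trans
      (expect_mono P W fun x y m₁ m₂ _ => min_le_right _ _)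

/-- In order of decreasing probability, at least G(x) elements are as likely as x, so q(x) G(x) ≤ ∑
q; then P = q · q^ρ. -/
theorem eveAltAmbiguity_le_renyiSum {ρ : ℝ} (hρ : 0 < ρ) (P : PMF (X × Y))
    (W : Encoder X Y M₁ M₂) : eveAltAmbiguity ρ P W ≤ renyiSum ρ P := by
  choose e he using fun y => exists_equiv_fin_succ_le_card fun x => -(P (x, y)).toReal
  refine (min_le_left _ _).trans ((ciInf_guess_le _ fun s => e s.1).trans ?_)
  refine (expect_const_hint P W fun x y => (((e y x : ℕ) + 1 : ℕ) : ℝ) ^ ρ).le.trans ?_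
  refine sum_le_sum fun y _ => ?_
  have hα : (1 / (1 + ρ)) * (1 + ρ) = 1 := one_div_mul_cancel (by positivity)
  have hS : 0 ≤ ∑ x, (P (x, y)).toReal ^ (1 / (1 + ρ)) := sum_nonneg fun x _ => by positivity
  rw [Real.rpow_one_add' hS (by positivity), sum_mul]
  refine sum_le_sum fun x _ => ?_
  set p := (P (x, y)).toReal with hp
  have hp0 : 0 ≤ p := ENNReal.toReal_nonneg
  have hq0 : 0 ≤ p ^ (1 / (1 + ρ)) := Real.rpow_nonneg hp0 _
  have hsplit : p = p ^ (1 / (1 + ρ)) * (p ^ (1 / (1 + ρ))) ^ ρ := by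
    rw [← Real.rpow_one_add' hq0 (by positivity), ← Real.rpow_mul hp0, hα, Real.rpow_one]
  have hG : p ^ (1 / (1 + ρ)) * (((e y x : ℕ) + 1 : ℕ) : ℝ) ≤
      ∑ x', (P (x', y)).toReal ^ (1 / (1 + ρ)) := by
    calc p ^ (1 / (1 + ρ)) * (((e y x : ℕ) + 1 : ℕ) : ℝ)
        ≤ p ^ (1 / (1 + ρ)) * (#{x' | -(P (x', y)).toReal ≤ -p} : ℝ) := by
          gcongr
          exact he y x
      _ = ∑ x' with -(P (x', y)).toReal ≤ -p, p ^ (1 / (1 + ρ)) := by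
          rw [sum_const, nsmul_eq_mul, mul_comm]
      _ ≤ ∑ x' with -(P (x', y)).toReal ≤ -p, (P (x', y)).toReal ^ (1 / (1 + ρ)) := by
          refine sum_le_sum fun x' hx' => Real.rpow_le_rpow hp0 ?_ (by positivity)
          exact neg_le_neg_iff.1 (mem_filter.1 hx').2
      _ ≤ _ := sum_le_sum_of_subset_of_nonneg (subset_univ _) fun _ _ _ => by positivity
  nth_rewrite 1 [hsplit]
  rw [mul_assoc, ← Real.mul_rpow hq0 (by positivity)]
  exact mul_le_mul_of_nonneg_left (Real.rpow_le_rpow (by positivity) hG hρ.le) hq0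

theorem eveAltAmbiguity_le_mul_bobListAmbiguity {ρ : ℝ} (hρ : 0 < ρ) (P : PMF (X × Y))
    (W : Encoder X Y M₁ M₂) :
    eveAltAmbiguity ρ P W ≤ (min (Fintype.card M₁ : ℝ) (Fintype.card M₂ : ℝ)) ^ ρ *
      bobListAmbiguity ρ P W := by
  rw [bobListAmbiguity, ← expect_const_mul]
  -- Revealing the hint with the larger alphabet leaves the fewest candidate lists, one per value of
  -- the other hint.
  rcases le_total (Fintype.card M₂ : ℝ) (Fintype.card M₁ : ℝ) with h | h
  · rw [min_eq_right h]
    choose e he using fun s : Y × M₁ =>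
      exists_equiv_fin_succ_le_card_mul_ncard fun m₂ => bobList P W s.1 s.2 m₂
    refine (min_le_left _ _).trans ((ciInf_guess_le _ e).trans (expect_mono P W ?_))
    intro x y m₁ m₂ hx
    rw [← Real.mul_rpow (by positivity) (by positivity)]
    refine Real.rpow_le_rpow (by positivity) ?_ hρ.le
    exact_mod_cast he (y, m₁) m₂ x ((mem_bobList_iff ..).2 hx)
  · rw [min_eq_left h]
    choose e he using fun s : Y × M₂ =>
      exists_equiv_fin_succ_le_card_mul_ncard fun m₁ => bobList P W s.1 m₁ s.2
    refine (min_le_right _ _).trans ((ciInf_guess_le _ e).trans (expect_mono P W ?_))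
    intro x y m₁ m₂ hx
    rw [← Real.mul_rpow (by positivity) (by positivity)]
    refine Real.rpow_le_rpow (by positivity) ?_ hρ.le
    exact_mod_cast he (y, m₂) m₁ x ((mem_bobList_iff ..).2 hx)

/-! ### Achievability: Bob's ambiguity -/

theorem sum_map_uniform_toReal_mul {U M : Type*} [Fintype U] [Nonempty U] [Fintype M] (g : U → M)
    (F : M → ℝ) :
    ∑ m, ((PMF.uniformOfFintype U).map g m).toReal * F m =
      (Fintype.card U : ℝ)⁻¹ * ∑ u, F (g u) := by
  classical
  have h : ∀ m, ((PMF.uniformOfFintype U).map g m).toReal =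
      ∑ u, if m = g u then (Fintype.card U : ℝ)⁻¹ else 0 := by
    intro m
    rw [PMF.map_apply, tsum_fintype, ENNReal.toReal_sum]
    · refine sum_congr rfl fun u _ => ?_
      split_ifs <;> simp
    · intro u _
      split_ifs <;> simp
  simp only [h, sum_mul, ite_mul, zero_mul]
  rw [sum_comm, mul_sum]
  exact sum_congr rfl fun u _ => by simp

variable {cs c₁ c₂ : ℕ} [NeZero cs]

theorem expect_padEncoder (P : PMF (X × Y)) (i₁ : Fin cs × Fin c₁ → M₁)
    (i₂ : Fin cs × Fin c₂ → M₂) (f : X → Y → Fin cs × Fin c₁ × Fin c₂)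
    (F : X → Y → M₁ → M₂ → ℝ) :
    expect P (padEncoder i₁ i₂ f) F = (cs : ℝ)⁻¹ * ∑ y, ∑ x, ∑ u : Fin cs, (P (x, y)).toReal *
      F x y (i₁ ((f x y).1 + u, (f x y).2.1)) (i₂ (u, (f x y).2.2)) := by
  rw [expect_eq_sum, mul_sum]
  refine sum_congr rfl fun y _ => ?_
  rw [mul_sum]
  refine sum_congr rfl fun x _ => ?_
  rw [padEncoder, sum_map_uniform_toReal_mul _ fun m : M₁ × M₂ => F x y m.1 m.2, Fintype.card_fin,
    ← mul_sum, mul_left_comm]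

theorem bobListAmbiguity_padEncoder_le {ρ : ℝ} (hρ : 0 < ρ) (P : PMF (X × Y))
    {i₁ : Fin cs × Fin c₁ → M₁} {i₂ : Fin cs × Fin c₂ → M₂} (hi₁ : Function.Injective i₁)
    (hi₂ : Function.Injective i₂) (f : X → Y → Fin cs × Fin c₁ × Fin c₂) (lam : Y → X → ℕ)
    (hf : ∀ y, ∀ x ∈ ({x | 0 < (P (x, y)).toReal} : Finset X),
      Set.ncard {x' | x' ∈ ({x | 0 < (P (x, y)).toReal} : Finset X) ∧ f x' y = f x y} ≤ lam y x) :
    bobListAmbiguity ρ P (padEncoder i₁ i₂ f) ≤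
      ∑ y, ∑ x, (P (x, y)).toReal * (lam y x : ℝ) ^ ρ := by
  rw [← expect_const_hint P (padEncoder i₁ i₂ f) fun x y => (lam y x : ℝ) ^ ρ]
  refine expect_mono P _ fun x y m₁ m₂ h => Real.rpow_le_rpow (by positivity) ?_ hρ.le
  have hx : 0 < (P (x, y)).toReal := pos_of_mul_pos_left h ENNReal.toReal_nonneg
  exact_mod_cast (Set.ncard_le_ncard (bobList_padEncoder_subset P hi₁ hi₂ f h)
    (Set.toFinite _)).trans (hf y x (by simpa using hx))

/-- Rounding up gives at most 1 if ξ ≤ 1 and at most 2ξ otherwise. This is the source of the summand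
1 in Bob's bound. -/
theorem natCeil_rpow_lt {ρ ξ : ℝ} (hρ : 0 < ρ) (hξ : 0 < ξ) :
    (⌈ξ⌉₊ : ℝ) ^ ρ < 1 + (2 * ξ) ^ ρ := by
  have hpos : 0 < (2 * ξ) ^ ρ := by positivity
  rcases le_or_gt ξ 1 with h | h
  · have h1 : (⌈ξ⌉₊ : ℝ) ≤ 1 := by exact_mod_cast Nat.ceil_le.2 (by exact_mod_cast h)
    have := Real.rpow_le_rpow (Nat.cast_nonneg _) h1 hρ.le
    rw [Real.one_rpow] at this
    linarith
  · have h1 : (⌈ξ⌉₊ : ℝ) ≤ 2 * ξ := by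
      have := Nat.ceil_lt_add_one hξ.le
      linarith
    have := Real.rpow_le_rpow (Nat.cast_nonneg _) h1 hρ.le
    linarith

/-- Task encoding with side information: short lists from a description with `T + log₂ |X| + 2`
values. -/
theorem exists_description {Z : Type*} [Fintype Z] {ρ : ℝ} (hρ : 0 < ρ) (P : PMF (X × Y)) {T : ℝ}
    (hT : 0 < T) (hZ : T + Real.logb 2 (Fintype.card X) + 2 ≤ Fintype.card Z) :
    ∃ (f : X → Y → Z) (lam : Y → X → ℕ),
      (∀ y, ∀ x ∈ ({x | 0 < (P (x, y)).toReal} : Finset X),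
        Set.ncard {x' | x' ∈ ({x | 0 < (P (x, y)).toReal} : Finset X) ∧ f x' y = f x y} ≤
          lam y x) ∧
      ∑ y, ∑ x, (P (x, y)).toReal * (lam y x : ℝ) ^ ρ < 1 + renyiSum ρ P * (T / 4) ^ (-ρ) := by
  obtain ⟨⟨x₀, y₀⟩, hxy⟩ := P.support_nonempty
  have : Nonempty X := ⟨x₀⟩
  have hp₀ : 0 < (P (x₀, y₀)).toReal :=
    ENNReal.toReal_pos ((P.mem_support_iff _).1 hxy) (P.apply_ne_top _)
  set q : Y → X → ℝ := fun y x => (P (x, y)).toReal ^ (1 / (1 + ρ)) with hq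
  set S : Y → ℝ := fun y => ∑ x, q y x with hS
  have hq0 : ∀ y x, 0 ≤ q y x := fun y x => by positivity
  have hS0 : ∀ y, 0 ≤ S y := fun y => sum_nonneg fun x _ => hq0 y x
  have hqpos : ∀ y x, 0 < (P (x, y)).toReal → 0 < q y x := fun y x h =>
    Real.rpow_pos_of_pos h _
  have hSpos : ∀ y x, 0 < (P (x, y)).toReal → 0 < S y := fun y x h =>
    sum_pos' (fun x _ => hq0 y x) ⟨x, mem_univ _, hqpos y x h⟩
  -- Ideal block size, proportional to 1/q and normalized so that ∑ 1/ξ ≤ T/2, as the partition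
  -- lemma requires.
  set ξ : Y → X → ℝ := fun y x => 2 * S y / (T * q y x) with hξ
  have hξpos : ∀ y x, 0 < (P (x, y)).toReal → 0 < ξ y x := fun y x h =>
    div_pos (mul_pos two_pos (hSpos y x h)) (mul_pos hT (hqpos y x h))
  set lam : Y → X → ℕ := fun y x => ⌈ξ y x⌉₊ with hlam
  have hsum : ∀ y, 2 * ∑ x with 0 < (P (x, y)).toReal, (lam y x : ℝ)⁻¹ ≤ T := by
    intro y
    calc 2 * ∑ x with 0 < (P (x, y)).toReal, (lam y x : ℝ)⁻¹
        ≤ 2 * ∑ x with 0 < (P (x, y)).toReal, (T / 2) * (q y x / S y) := by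
          refine mul_le_mul_of_nonneg_left (sum_le_sum fun x hx => ?_) two_pos.le
          have hx' : 0 < (P (x, y)).toReal := by simpa using hx
          have h1 := inv_anti₀ (hξpos y x hx') (Nat.le_ceil (ξ y x))
          refine h1.trans (le_of_eq ?_)
          have := hSpos y x hx'
          have := hqpos y x hx'
          simp only [hξ]
          field_simp
      _ = T * ((∑ x with 0 < (P (x, y)).toReal, q y x) / S y) := by
          rw [← mul_sum, ← sum_div]; ring
      _ ≤ T * 1 := by
          refine mul_le_mul_of_nonneg_left (div_le_one_of_le₀ ?_ (hS0 y)) hT.le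
          exact sum_le_sum_of_subset_of_nonneg (subset_univ _) fun x _ _ => hq0 y x
      _ = T := mul_one T
  choose f hf using fun y => exists_partition (Z := Z) {x | 0 < (P (x, y)).toReal} (lam y)
    (fun x hx => Nat.ceil_pos.2 (hξpos y x (by simpa using hx))) (hsum y) hZ
  refine ⟨fun x y => f y x, lam, hf, ?_⟩
  have hα : (1 / (1 + ρ)) * (1 + ρ) = 1 := one_div_mul_cancel (by positivity)
  have hsplit : ∀ y x, (P (x, y)).toReal = q y x * (q y x) ^ ρ := by
    intro y x
    rw [← Real.rpow_one_add' (hq0 y x) (by positivity), hq, ← Real.rpow_mul ENNReal.toReal_nonneg,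
      hα, Real.rpow_one]
  -- Here 2ξ = 4S/(Tq), so P (2ξ)^ρ = q (S/(T/4))^ρ: the 4 combines the rounding loss with the 2 in
  -- ξ.
  have hlt : ∀ y x, 0 < (P (x, y)).toReal → (P (x, y)).toReal * (lam y x : ℝ) ^ ρ <
      (P (x, y)).toReal + q y x * (S y ^ ρ * (T / 4) ^ (-ρ)) := by
    intro y x h
    have h1 := mul_lt_mul_of_pos_left (natCeil_rpow_lt hρ (hξpos y x h)) h
    refine h1.trans_eq ?_
    rw [mul_add, mul_one]
    congr 1
    nth_rewrite 1 [hsplit y x]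
    have hqp := hqpos y x h
    have hSp := hSpos y x h
    rw [mul_assoc, Real.rpow_neg (by positivity), ← Real.inv_rpow (by positivity),
      ← Real.mul_rpow (hq0 y x) (by simp only [hξ]; positivity),
      ← Real.mul_rpow (hS0 y) (by positivity)]
    congr 2
    simp only [hξ]
    field_simp
    norm_num
  have hle : ∀ y x, (P (x, y)).toReal * (lam y x : ℝ) ^ ρ ≤
      (P (x, y)).toReal + q y x * (S y ^ ρ * (T / 4) ^ (-ρ)) := by
    intro y x
    rcases (ENNReal.toReal_nonneg (a := P (x, y))).eq_or_lt with h | h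
    · rw [← h, zero_mul, zero_add]
      have := hq0 y x
      have := hS0 y
      positivity
    · exact (hlt y x h).le
  calc ∑ y, ∑ x, (P (x, y)).toReal * (lam y x : ℝ) ^ ρ
      < ∑ y, ∑ x, ((P (x, y)).toReal + q y x * (S y ^ ρ * (T / 4) ^ (-ρ))) :=
        sum_lt_sum (fun y _ => sum_le_sum fun x _ => hle y x)
          -- Strictness needs only one pair of positive probability.
          ⟨y₀, mem_univ _, sum_lt_sum (fun x _ => hle y₀ x) ⟨x₀, mem_univ _, hlt y₀ x₀ hp₀⟩⟩
    _ = 1 + renyiSum ρ P * (T / 4) ^ (-ρ) := by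
        simp only [sum_add_distrib]
        rw [sum_sum_toReal, renyiSum, sum_mul]
        congr 1
        refine sum_congr rfl fun y _ => ?_
        rw [← sum_mul, Real.rpow_one_add' (hS0 y) (by positivity), mul_assoc]

/-! ### Achievability: Eve's ambiguity -/

/-- 1/min is at most the sum of the two reciprocals. As u runs over all pads, so does vₛ + u;
enlarging to all values of v₁ (or v₂) leaves one harmonic sum for each of the c_s c₁ (or c_s c₂)
hint values. -/
theorem sum_min_inv_le (v : X → Fin cs × Fin c₁ × Fin c₂)
    (g₁ : Fin cs × Fin c₁ → X ≃ Fin (Fintype.card X))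
    (g₂ : Fin cs × Fin c₂ → X ≃ Fin (Fintype.card X)) :
    ∑ i : X × Fin cs, (min ((((g₁ ((v i.1).1 + i.2, (v i.1).2.1) i.1 : ℕ) + 1 : ℕ) : ℝ))
      (((g₂ (i.2, (v i.1).2.2) i.1 : ℕ) + 1 : ℕ) : ℝ))⁻¹ ≤
      cs * ((c₁ + c₂) * (1 + Real.log (Fintype.card X))) := by
  set h := 1 + Real.log (Fintype.card X)
  let r : X ≃ Fin (Fintype.card X) → X → ℝ := fun e x => (((e x : ℕ) + 1 : ℕ) : ℝ)⁻¹
  have hr : ∀ e x, 0 ≤ r e x := fun e x => by positivity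
  have hgen : ∀ (c : ℕ) (g : Fin cs × Fin c → X ≃ Fin (Fintype.card X)),
      ∑ s : Fin cs, ∑ j : Fin c, ∑ x, r (g (s, j)) x ≤ cs * (c * h) := by
    intro c g
    calc ∑ s : Fin cs, ∑ j : Fin c, ∑ x, r (g (s, j)) x
        ≤ ∑ _s : Fin cs, ∑ _j : Fin c, h :=
          sum_le_sum fun s _ => sum_le_sum fun j _ => sum_inv_guess_le _
      _ = _ := by simp
  have h1 : ∑ x, ∑ u : Fin cs, r (g₁ ((v x).1 + u, (v x).2.1)) x ≤ cs * (c₁ * h) := by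
    refine le_trans ?_ (hgen c₁ g₁)
    calc ∑ x, ∑ u : Fin cs, r (g₁ ((v x).1 + u, (v x).2.1)) x
        = ∑ x, ∑ s : Fin cs, r (g₁ (s, (v x).2.1)) x :=
          sum_congr rfl fun x _ =>
            Equiv.sum_comp (Equiv.addLeft (v x).1) fun s => r (g₁ (s, (v x).2.1)) x
      _ ≤ ∑ x, ∑ s : Fin cs, ∑ j : Fin c₁, r (g₁ (s, j)) x :=
          sum_le_sum fun x _ => sum_le_sum fun s _ =>
            single_le_sum (f := fun j => r (g₁ (s, j)) x) (fun j _ => hr _ _) (mem_univ _)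
      _ = _ := by
          rw [sum_comm]
          exact sum_congr rfl fun s _ => sum_comm
  have h2 : ∑ x, ∑ u : Fin cs, r (g₂ (u, (v x).2.2)) x ≤ cs * (c₂ * h) := by
    refine le_trans ?_ (hgen c₂ g₂)
    calc ∑ x, ∑ u : Fin cs, r (g₂ (u, (v x).2.2)) x
        ≤ ∑ x, ∑ s : Fin cs, ∑ j : Fin c₂, r (g₂ (s, j)) x :=
          sum_le_sum fun x _ => sum_le_sum fun s _ =>
            single_le_sum (f := fun j => r (g₂ (s, j)) x) (fun j _ => hr _ _) (mem_univ _)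
      _ = _ := by
          rw [sum_comm]
          exact sum_congr rfl fun s _ => sum_comm
  rw [Fintype.sum_prod_type]
  calc _ ≤ ∑ x, ∑ u : Fin cs, (r (g₁ ((v x).1 + u, (v x).2.1)) x + r (g₂ (u, (v x).2.2)) x) := by
        refine sum_le_sum fun x _ => sum_le_sum fun u _ => ?_
        rcases min_choice ((((g₁ ((v x).1 + u, (v x).2.1) x : ℕ) + 1 : ℕ) : ℝ))
          (((g₂ (u, (v x).2.2) x : ℕ) + 1 : ℕ) : ℝ) with he | he
        · rw [he]; exact le_add_of_nonneg_right (hr _ _)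
        · rw [he]; exact le_add_of_nonneg_left (hr _ _)
    _ ≤ cs * (c₁ * h) + cs * (c₂ * h) := by
        simp only [sum_add_distrib]
        exact add_le_add h1 h2
    _ = _ := by ring

theorem le_eveAmbiguity_padEncoder {ρ : ℝ} (hρ : 0 < ρ) (P : PMF (X × Y)) (hc₁ : 0 < c₁)
    (i₁ : Fin cs × Fin c₁ → M₁) (i₂ : Fin cs × Fin c₂ → M₂)
    (f : X → Y → Fin cs × Fin c₁ × Fin c₂) :
    (1 + Real.log (Fintype.card X)) ^ (-ρ) * (renyiSum ρ P * ((c₁ : ℝ) + c₂) ^ (-ρ)) ≤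
      eveAmbiguity ρ P (padEncoder i₁ i₂ f) := by
  have hcs : (0 : ℝ) < cs := by exact_mod_cast Nat.pos_of_ne_zero (NeZero.ne cs)
  have hc : (0 : ℝ) < (c₁ : ℝ) + c₂ := by positivity
  have hlog : 0 ≤ Real.log (Fintype.card X) := Real.log_natCast_nonneg _
  set h := 1 + Real.log (Fintype.card X) with hh
  have hpos : 0 < h := by positivity
  have hD : 0 < ((c₁ : ℝ) + c₂) * h := mul_pos hc hpos
  refine le_ciInf fun G => ?_
  rw [expect_padEncoder]
  have hy : ∀ y, cs * (∑ x, (P (x, y)).toReal ^ (1 / (1 + ρ))) ^ (1 + ρ) ≤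
      (∑ x, ∑ u : Fin cs, (P (x, y)).toReal *
        min ((guessNo G.1 x (y, i₁ ((f x y).1 + u, (f x y).2.1)) : ℝ) ^ ρ)
          ((guessNo G.2 x (y, i₂ (u, (f x y).2.2)) : ℝ) ^ ρ)) * (((c₁ : ℝ) + c₂) * h) ^ ρ := by
    intro y
    let a : X × Fin cs → ℝ := fun i =>
      min (guessNo G.1 i.1 (y, i₁ ((f i.1 y).1 + i.2, (f i.1 y).2.1)) : ℝ)
        (guessNo G.2 i.1 (y, i₂ (i.2, (f i.1 y).2.2)) : ℝ)
    have ha : ∀ i, 0 < a i := fun i =>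
      lt_min (by rw [guessNo]; positivity) (by rw [guessNo]; positivity)
    have key := sum_rpow_le_moment_mul univ hρ (fun i : X × Fin cs => (P (i.1, y)).toReal) a
      (fun _ _ => ENNReal.toReal_nonneg) fun i _ => ha i
    have hinv : ∑ i, (a i)⁻¹ ≤ cs * (((c₁ : ℝ) + c₂) * h) :=
      sum_min_inv_le (fun x => f x y) (fun s => G.1 (y, i₁ s)) fun s => G.2 (y, i₂ s)
    have hS : 0 ≤ ∑ x, (P (x, y)).toReal ^ (1 / (1 + ρ)) := sum_nonneg fun x _ => by positivity
    have e1 : ∑ i : X × Fin cs, (P (i.1, y)).toReal ^ (1 / (1 + ρ)) =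
        cs * ∑ x, (P (x, y)).toReal ^ (1 / (1 + ρ)) := by
      rw [Fintype.sum_prod_type, mul_sum]
      simp
    have e2 : ∑ i : X × Fin cs, (P (i.1, y)).toReal * a i ^ ρ =
        ∑ x, ∑ u : Fin cs, (P (x, y)).toReal *
          min ((guessNo G.1 x (y, i₁ ((f x y).1 + u, (f x y).2.1)) : ℝ) ^ ρ)
            ((guessNo G.2 x (y, i₂ (u, (f x y).2.2)) : ℝ) ^ ρ) := by
      rw [Fintype.sum_prod_type]
      refine sum_congr rfl fun x _ => sum_congr rfl fun u _ => ?_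
      congr 1
      exact (Real.monotoneOn_rpow_Ici_of_exponent_nonneg hρ.le).map_min
        (Set.mem_Ici.2 (Nat.cast_nonneg _)) (Set.mem_Ici.2 (Nat.cast_nonneg _))
    -- Summing over pads yields c_s^{1+ρ} on the left and c_s^ρ on the right; the leftover c_s
    -- cancels against the average over u, so the bound is free of c_s.
    rw [e1, e2, Real.mul_rpow hcs.le hS, Real.rpow_one_add' hcs.le (by positivity)] at key
    rw [← e2] at key ⊢
    have hM : 0 ≤ ∑ i : X × Fin cs, (P (i.1, y)).toReal * a i ^ ρ :=
      sum_nonneg fun i _ => mul_nonneg ENNReal.toReal_nonneg (Real.rpow_nonneg (ha i).le _)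
    have h3 := key.trans (mul_le_mul_of_nonneg_left (Real.rpow_le_rpow
      (sum_nonneg fun i _ => inv_nonneg.2 (ha i).le) hinv hρ.le) hM)
    rw [Real.mul_rpow hcs.le hD.le] at h3
    refine le_of_mul_le_mul_left ?_ (Real.rpow_pos_of_pos hcs ρ)
    linarith
  have hsum := sum_le_sum fun y (_ : y ∈ univ) => hy y
  rw [← mul_sum, ← sum_mul, ← renyiSum] at hsum
  rw [mul_left_comm, ← Real.mul_rpow hpos.le hc.le, mul_comm h, Real.rpow_neg hD.le,
    ← div_eq_mul_inv, div_le_iff₀ (Real.rpow_pos_of_pos hD ρ), mul_assoc, inv_mul_eq_div,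
    le_div_iff₀ hcs, mul_comm]
  exact hsum

theorem exists_injective_of_le_floor {M : Type*} [Fintype M] {cs c : ℕ} (hcs : 0 < cs)
    (h : c ≤ ⌊(Fintype.card M : ℝ) / (cs : ℝ)⌋₊) :
    ∃ i : Fin cs × Fin c → M, Function.Injective i := by
  rw [Nat.floor_div_natCast, Nat.floor_natCast, Nat.le_div_iff_mul_le hcs] at h
  obtain ⟨i⟩ := Function.Embedding.nonempty_of_card_le (α := Fin cs × Fin c) (β := M)
    (by simpa [mul_comm] using h)
  exact ⟨i, i.injective⟩

end

end DistStor

/-! ### Assembly -/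

theorem mainTheorem4 {X Y M₁ M₂ : Type*} [Fintype X] [Fintype Y] [Fintype M₁] [Fintype M₂]
    (P : PMF (X × Y)) (ρ : ℝ) (hρ : 0 < ρ) :
    -- achievability
    (Real.logb 2 (Fintype.card X) + 2 < (Fintype.card M₁ : ℝ) * (Fintype.card M₂ : ℝ) →
      ∀ cs c₁ c₂ : ℕ, 1 ≤ cs → 1 ≤ c₁ → 1 ≤ c₂ →
        cs ≤ min (Fintype.card M₁) (Fintype.card M₂) →
        c₁ ≤ ⌊(Fintype.card M₁ : ℝ) / (cs : ℝ)⌋₊ →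
        c₂ ≤ ⌊(Fintype.card M₂ : ℝ) / (cs : ℝ)⌋₊ →
        Real.logb 2 (Fintype.card X) + 2 < (cs : ℝ) * (c₁ : ℝ) * (c₂ : ℝ) →
        ∃ W : DistStor.Encoder X Y M₁ M₂,
          DistStor.bobListAmbiguity ρ P W <
            1 + (2 : ℝ) ^ (ρ * (DistStor.condRenyiEntropy (1 / (1 + ρ)) P
              - Real.logb 2 ((cs : ℝ) * (c₁ : ℝ) * (c₂ : ℝ)
                  - Real.logb 2 (Fintype.card X) - 2) + 2)) ∧
          (1 + Real.log (Fintype.card X)) ^ (-ρ) *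
              (2 : ℝ) ^ (ρ * (DistStor.condRenyiEntropy (1 / (1 + ρ)) P
                - Real.logb 2 ((c₁ : ℝ) + (c₂ : ℝ)))) ≤
            DistStor.eveAmbiguity ρ P W) ∧
    -- converse
    (∀ W : DistStor.Encoder X Y M₁ M₂,
      max ((2 : ℝ) ^ (ρ * (DistStor.condRenyiEntropy (1 / (1 + ρ)) P
            - Real.logb 2 ((Fintype.card M₁ : ℝ) * (Fintype.card M₂ : ℝ))))) 1 ≤
          DistStor.bobListAmbiguity ρ P W ∧
      DistStor.eveAmbiguity ρ P W ≤
        min ((min (Fintype.card M₁ : ℝ) (Fintype.card M₂ : ℝ)) ^ ρ *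
              DistStor.bobListAmbiguity ρ P W)
          ((2 : ℝ) ^ (ρ * DistStor.condRenyiEntropy (1 / (1 + ρ)) P)) ∧
      DistStor.eveAltAmbiguity ρ P W ≤
        min ((min (Fintype.card M₁ : ℝ) (Fintype.card M₂ : ℝ)) ^ ρ *
              DistStor.bobListAmbiguity ρ P W)
          ((2 : ℝ) ^ (ρ * DistStor.condRenyiEntropy (1 / (1 + ρ)) P))) := by
  refine ⟨fun _ cs c₁ c₂ hcs hc₁ _ _ hf₁ hf₂ hT => ?_, fun W => ⟨max_le ?_ ?_, ?_, ?_⟩⟩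
  · have : NeZero cs := ⟨by omega⟩
    obtain ⟨i₁, hi₁⟩ := DistStor.exists_injective_of_le_floor hcs hf₁
    obtain ⟨i₂, hi₂⟩ := DistStor.exists_injective_of_le_floor hcs hf₂
    set T := (cs : ℝ) * (c₁ : ℝ) * (c₂ : ℝ) - Real.logb 2 (Fintype.card X) - 2 with hTdef
    have hT0 : 0 < T := by linarith
    obtain ⟨f, lam, hf, hlt⟩ := DistStor.exists_description (Z := Fin cs × Fin c₁ × Fin c₂)
      hρ P hT0 (by simp only [Fintype.card_prod, Fintype.card_fin]; push_cast; linarith)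
    refine ⟨DistStor.padEncoder i₁ i₂ f,
      (DistStor.bobListAmbiguity_padEncoder_le hρ P hi₁ hi₂ f lam hf).trans_lt ?_, ?_⟩
    -- The constant 4 from the block sizes becomes the +2 in Bob's exponent.
    · have h4 : Real.logb 2 (T / 4) = Real.logb 2 T - 2 := by
        rw [Real.logb_div hT0.ne' (by norm_num), show (4 : ℝ) = 2 ^ (2 : ℝ) by norm_num,
          Real.logb_rpow two_pos (by norm_num)]
      rw [← DistStor.two_rpow_entropy_sub hρ P (by positivity), h4, ← sub_add] at hlt
      exact hlt
    · rw [DistStor.two_rpow_entropy_sub hρ P (by positivity)]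
      exact DistStor.le_eveAmbiguity_padEncoder hρ P hc₁ i₁ i₂ f
  -- Both hint alphabets are nonempty because `W` supplies a PMF on their product.
  · obtain ⟨⟨m₁, m₂⟩, -⟩ := (W P.support_nonempty.some).support_nonempty
    have h₁ : 0 < Fintype.card M₁ := Fintype.card_pos_iff.2 ⟨m₁⟩
    have h₂ : 0 < Fintype.card M₂ := Fintype.card_pos_iff.2 ⟨m₂⟩
    have hc : (0 : ℝ) < (Fintype.card M₁ : ℝ) * (Fintype.card M₂ : ℝ) := by positivity
    rw [DistStor.two_rpow_entropy_sub hρ P hc, Real.rpow_neg hc.le, ← div_eq_mul_inv,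
      div_le_iff₀ (Real.rpow_pos_of_pos hc ρ)]
    exact DistStor.renyiSum_le_bobListAmbiguity_mul hρ P W
  · exact DistStor.one_le_bobListAmbiguity hρ P W
  · rw [DistStor.two_rpow_entropy hρ]
    exact (DistStor.eveAmbiguity_le_eveAltAmbiguity P W).trans
      (le_min (DistStor.eveAltAmbiguity_le_mul_bobListAmbiguity hρ P W)
        (DistStor.eveAltAmbiguity_le_renyiSum hρ P W))
  · rw [DistStor.two_rpow_entropy hρ]
    exact le_min (DistStor.eveAltAmbiguity_le_mul_bobListAmbiguity hρ P W)
      (DistStor.eveAltAmbiguity_le_renyiSum hρ P W)
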